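/- **Theorem (lower bound on regret).** *Setting.* In hierarchical inference, a problem instance consists of a finite non-empty set $\Phi\subset(0,1]$ of confidence values, a non-decreasing accuracy mapping $f:(0,1]\to[0,1]$, and a probability law on $[0,1]$ with mean $\gamma$. In each slot $t=1,\dots,T$ a sample with confidence value $\phi(t)\in\Phi$ arrives. Its local inference is wrong with probability $1-f(\phi(t))$ (let $\eta_t\in\{0,1\}$ be the error indicator), and $\Gamma_t\in[0,1]$ is its offloading cost; the $\Gamma_t$ are i.i.d. with the given law, and all $\eta_t$ and $\Gamma_t$ are independent. An online policy $\pi$ (possibly randomized; it may know $\Phi$ and $T$, but is not given $f$ or the cost law) sees $\phi(t)$ and decides, from its own randomness, the current and past confidence values and the past feedback, either to offload ($D_\pi(t)=1$) or to accept the local inference ($D_\pi(t)=0$). If it offloads, it observes $\eta_t$ and $\Gamma_t$; if it accepts, it observes nothing. The cost of the slot is $L^\pi_t=\Gamma_tD_\pi(t)+\eta_t(1-D_\pi(t))$. Let $\pi^*$ be the optimal static threshold policy, which accepts if and only if $1-f(\phi(t))<\gamma$. The adversarial regret is $$R^A_\pi(T)=\max_{(\phi(1),\dots,\phi(T))\in\Phi^T}\mathbb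 E\Big[\sum_{t=1}^T L^\pi_t-\sum_{t=1}^T L^{\pi^*}_t\Big].$$ *Claim.* The minimax adversarial regret is $\Omega(\log T)$, that is: (i) there are constants $c>0$ and $T_0$ such that for every $T\ge T_0$ and every policy $\pi$ there is a problem instance for which $R^A_\pi(T)\ge c\log T$; (ii) this remains true when the accuracy mapping is held fixed: for every non-decreasing $f:(0,1]\to[0,1]$ with $0<f(\phi)<1$ for some $\phi\in(0,1]$, there are $c>0$ and $T_0$ (depending only on $f$) such that for every $T\ge T_0$ and every policy $\pi$ there are a finite non-empty set $\Phi\subset(0,1]$ and an offloading-cost law on $[0,1]$ for which, with this $f$, $R^A_\pi(T)\ge c\log T$. -/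

import Mathlib

open MeasureTheory

universe u

noncomputable section

namespace HI

/-- A problem instance of hierarchical inference: a finite non-empty set `Φ ⊆ (0, 1]` of confidence
values, a non-decreasing accuracy mapping `f` with values in `[0, 1]` (only its values on confidence
levels in `(0, 1]` matter), and the common law on `[0, 1]` of the i.i.d. offloading costs. -/
structure Problem where
  Φ : Finset ℝ
  Φ_nonempty : Φ.Nonempty
  Φ_subset : ∀ φ ∈ Φ, φ ∈ Set.Ioc (0 : ℝ) 1
  f : ℝ → ℝ
  f_mono : MonotoneOn f (Set.Ioc 0 1)
  f_mem : ∀ φ ∈ Set.Ioc (0 : ℝ) 1, f φ ∈ Set.Icc (0 : ℝ) 1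
  costLaw : Measure unitInterval
  costLaw_prob : IsProbabilityMeasure costLaw

/-- The mean offloading cost `γ`. -/
def Problem.γ (I : Problem) : ℝ := ∫ x, (x : ℝ) ∂I.costLaw

/-- What a device learns about a slot after deciding: nothing (`Sum.inl ()`) if it accepts the local
inference; whether the local inference was wrong, and the offloading cost, if it offloads. -/
abbrev Feedback : Type := Unit ⊕ (Bool × unitInterval)

/-- The record of one past slot: the confidence value and the feedback. -/
abbrev Obs (Φ : Finset ℝ) : Type := Φ × Feedback

/-- A (possibly randomized) online policy for the confidence set `Φ`.  It draws a private random
seed, and in slot `t` (counted from `0`) decides from the seed, the records of the `t` earlier slots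
and the current confidence value; `true` means "offload", `false` means "accept".  It has no access
to `f` or to the law of the offloading costs. -/
structure Policy (Φ : Finset ℝ) where
  Seed : Type u
  seedSpace : MeasurableSpace Seed
  seedLaw : Measure Seed
  seedLaw_prob : IsProbabilityMeasure seedLaw
  act : (t : ℕ) → Seed → (Fin t → Obs Φ) → Φ → Bool
  measurable_act : ∀ (t : ℕ) (φ : Φ),
    Measurable (fun p : Seed × (Fin t → Obs Φ) => act t p.1 p.2 φ)

attribute [instance] Problem.costLaw_prob Policy.seedSpace Policy.seedLaw_prob

/-- The records of the first `t` slots when the policy `π` with seed `s` runs on the arrivals `σ`,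
where `e i` says whether the local inference in slot `i` is wrong and `g i` is the offloading cost
of slot `i`. -/
def Policy.history {Φ : Finset ℝ} (π : Policy.{u} Φ) {T : ℕ} (σ : Fin T → Φ) (s : π.Seed)
    (e : Fin T → Bool) (g : Fin T → unitInterval) : (t : ℕ) → t ≤ T → (Fin t → Obs Φ)
  | 0, _ => Fin.elim0
  | t + 1, h =>
    Fin.snoc (α := fun _ => Obs Φ) (π.history σ s e g t (Nat.le_of_succ_le h))
      (σ ⟨t, h⟩,
        if π.act t s (π.history σ s e g t (Nat.le_of_succ_le h)) (σ ⟨t, h⟩) = true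
        then Sum.inr (e ⟨t, h⟩, g ⟨t, h⟩) else Sum.inl ())

/-- The decision of the policy in slot `t`. -/
def Policy.decision {Φ : Finset ℝ} (π : Policy.{u} Φ) {T : ℕ} (σ : Fin T → Φ) (s : π.Seed)
    (e : Fin T → Bool) (g : Fin T → unitInterval) (t : Fin T) : Bool :=
  π.act t s (π.history σ s e g t t.isLt.le) (σ t)

/-- The cost of a slot with decision `d`: the offloading cost `g` if the sample is offloaded, and
otherwise one unit if the local inference is wrong. -/
def slotCost (d e : Bool) (g : unitInterval) : ℝ :=
  if d = true then (g : ℝ) else if e = true then 1 else 0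

/-- The law of the error indicator of the local inference at confidence `φ`: it is wrong with
probability `1 - f φ`. -/
def Problem.errorLaw (I : Problem) (φ : ℝ) : Measure Bool :=
  ENNReal.ofReal (1 - I.f φ) • Measure.dirac true + ENNReal.ofReal (I.f φ) • Measure.dirac false

/-- The joint law of error indicators and offloading costs along the arrivals `σ`: all independent,
with the costs identically distributed. -/
def Problem.envLaw (I : Problem) {T : ℕ} (σ : Fin T → I.Φ) :
    Measure ((Fin T → Bool) × (Fin T → unitInterval)) :=
  (Measure.pi fun t => I.errorLaw (σ t)).prod (Measure.pi fun _ => I.costLaw)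

/-- The decision of the optimal static threshold policy: accept exactly if `1 - f φ < γ`. -/
def Problem.optDecision (I : Problem) (φ : I.Φ) : Bool := decide (I.γ ≤ 1 - I.f φ)

instance Problem.errorLaw_prob (I : Problem) (φ : I.Φ) : IsProbabilityMeasure (I.errorLaw φ) := by
  have h := I.f_mem φ (I.Φ_subset φ φ.2)
  constructor
  simp only [Problem.errorLaw, Measure.add_apply, Measure.smul_apply, measure_univ, smul_eq_mul,
    mul_one]
  rw [← ENNReal.ofReal_add (by linarith [h.2]) h.1]
  simp

/-- The optimal decision is that of a static threshold policy. -/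
theorem Problem.exists_threshold (I : Problem) :
    ∃ θ : ℝ, ∀ φ : I.Φ, I.optDecision φ = decide ((φ : ℝ) < θ) := by
  classical
  by_cases h : ∃ φ ∈ I.Φ, 1 - I.f φ < I.γ
  · let S := I.Φ.filter fun φ => 1 - I.f φ < I.γ
    have hS : S.Nonempty := by
      obtain ⟨φ, h1, h2⟩ := h
      exact ⟨φ, Finset.mem_filter.2 ⟨h1, h2⟩⟩
    have hm := Finset.mem_filter.1 (S.min'_mem hS)
    refine ⟨S.min' hS, fun φ => ?_⟩
    simp only [Problem.optDecision, decide_eq_decide]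
    constructor
    · intro hle
      by_contra! hlt
      have := I.f_mono (I.Φ_subset _ hm.1) (I.Φ_subset _ φ.2) hlt
      linarith [hm.2]
    · intro hlt
      by_contra! hle
      exact absurd (S.min'_le φ (Finset.mem_filter.2 ⟨φ.2, hle⟩)) (not_le.2 hlt)
  · push Not at h
    refine ⟨2, fun φ => ?_⟩
    have h2 := (I.Φ_subset φ φ.2).2
    simp only [Problem.optDecision, decide_eq_decide]
    exact ⟨fun _ => by linarith, fun _ => h φ φ.2⟩

theorem Problem.integral_slotCost (I : Problem) {T : ℕ} (σ : Fin T → I.Φ) (d : Bool) (t : Fin T) :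
    Integrable (fun ω => slotCost d (ω.1 t) (ω.2 t)) (I.envLaw σ) ∧
      ∫ ω, slotCost d (ω.1 t) (ω.2 t) ∂(I.envLaw σ) =
        if d = true then I.γ else 1 - I.f (σ t) := by
  have h := I.f_mem (σ t) (I.Φ_subset _ (σ t).2)
  have hg : MeasurePreserving
      (fun ω : (Fin T → Bool) × (Fin T → unitInterval) => ω.2 t) (I.envLaw σ) I.costLaw :=
    (measurePreserving_eval (fun _ : Fin T => I.costLaw) t).comp measurePreserving_snd
  have he : MeasurePreserving
      (fun ω : (Fin T → Bool) × (Fin T → unitInterval) => ω.1 t) (I.envLaw σ)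
        (I.errorLaw (σ t)) :=
    (measurePreserving_eval (fun t : Fin T => I.errorLaw (σ t)) t).comp measurePreserving_fst
  cases d
  · have hi : Integrable (fun e : Bool => if e = true then (1 : ℝ) else 0) (I.errorLaw (σ t)) :=
      Integrable.of_finite
    refine ⟨by
      simpa [slotCost, Function.comp_def] using he.integrable_comp_of_integrable hi, ?_⟩
    have := integral_map he.measurable.aemeasurable
      (f := fun e : Bool => if e = true then (1 : ℝ) else 0)
      (by rw [he.map_eq]; exact hi.aestronglyMeasurable)
    rw [he.map_eq] at this
    simp only [slotCost, Bool.false_eq_true, if_false]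
    rw [← this, Problem.errorLaw, integral_add_measure
      ((integrable_dirac (by simp)).smul_measure ENNReal.ofReal_ne_top)
      ((integrable_dirac (by simp)).smul_measure ENNReal.ofReal_ne_top)]
    simp [integral_smul_measure, ENNReal.toReal_ofReal, h.1, sub_nonneg.2 h.2]
  · have hm : Measurable (fun x : unitInterval => (x : ℝ)) := measurable_subtype_coe
    have hi : Integrable (fun x : unitInterval => (x : ℝ)) I.costLaw :=
      Integrable.of_bound hm.aestronglyMeasurable 1
        (Filter.Eventually.of_forall fun x => by
          rw [Real.norm_of_nonneg x.2.1]; exact x.2.2)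
    refine ⟨by
      simpa [slotCost, Function.comp_def] using hg.integrable_comp_of_integrable hi, ?_⟩
    have := integral_map (μ := I.envLaw σ) hg.measurable.aemeasurable (f := fun x : unitInterval => (x : ℝ))
      hm.aestronglyMeasurable
    rw [hg.map_eq] at this
    simpa [slotCost, Problem.γ] using this.symm

/-- Along every arrival sequence, no static policy (in particular no static threshold policy) has a
smaller expected cumulative cost than the optimal decisions. -/
theorem Problem.optDecision_optimal (I : Problem) {T : ℕ} (σ : Fin T → I.Φ) (D : I.Φ → Bool) :
    ∫ ω, ∑ t, slotCost (I.optDecision (σ t)) (ω.1 t) (ω.2 t) ∂(I.envLaw σ) ≤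
      ∫ ω, ∑ t, slotCost (D (σ t)) (ω.1 t) (ω.2 t) ∂(I.envLaw σ) := by
  rw [integral_finsetSum _ fun t _ => (I.integral_slotCost σ _ t).1,
    integral_finsetSum _ fun t _ => (I.integral_slotCost σ _ t).1]
  refine Finset.sum_le_sum fun t _ => ?_
  rw [(I.integral_slotCost σ _ t).2, (I.integral_slotCost σ _ t).2, Problem.optDecision]
  by_cases h : I.γ ≤ 1 - I.f (σ t) <;> cases D (σ t) <;> simp [h]; linarith

/-- The adversarial regret of `π` over `T` slots: the maximum over all arrival sequences
`σ ∈ Φ ^ T` of the expected difference between the cumulative costs of `π` and of the optimal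
static threshold policy.  The expectation is over the seed of `π`, the correctness of the local
inferences and the offloading costs.  (The supremum is over a finite non-empty set.) -/
def Problem.regret (I : Problem) (π : Policy.{u} I.Φ) (T : ℕ) : ℝ :=
  ⨆ σ : Fin T → I.Φ,
    ∫ ω : π.Seed × ((Fin T → Bool) × (Fin T → unitInterval)),
      ((∑ t, slotCost (π.decision σ ω.1 ω.2.1 ω.2.2 t) (ω.2.1 t) (ω.2.2 t))
        - ∑ t, slotCost (I.optDecision (σ t)) (ω.2.1 t) (ω.2.2 t))
      ∂(π.seedLaw.prod (I.envLaw σ))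

end HI

end

/-! The proof is a two-point argument and yields the stronger order `√T`. Fix one confidence value
`φ` with `0 < f φ < 1`, put `p = 1 - f φ`, and let every arrival be `φ`. Compare two Bernoulli cost
laws with means `p - Δ` and `p + Δ`, where `Δ` is of order `1 / √T`. Under the first it is optimal
to offload always, under the second never, and each wrong decision costs `Δ` on average. With `N`
the number of offloads, the regrets are thus at least `Δ (T - E₀ N)` and `Δ E₁ N`.

At this scale the joint laws of all `T` costs are close in χ²-distance, so `E₁ N ≥ E₀ N - T / 2`. If
`E₀ N ≤ 3 T / 4` the first regret is at least `Δ T / 4`; otherwise the second is.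

Two facts carry this. `Problem.integral_regret` replaces realized costs by mean gaps, because a
decision is independent of the error and cost of its own slot. `integral_sub_le_integral_tiltedLaw`
is the change of measure. It compares the laws of the entire environment, observed or not, so no
analysis of the feedback is needed. -/

namespace HI

/-! ### Independence through resampling one coordinate. -/

section Resampling

/-- Redrawing part of `ω` from a fresh `y` keeps the law. If `D` ignores that part and `h` sees only
it, then after redrawing the integrand is a product of functions of independent variables. This
gives independence without describing a σ-algebra of the past. -/
theorem integral_mul_of_resample {Ω Y : Type*} [MeasurableSpace Ω] [MeasurableSpace Y]
    {μ : Measure Ω} {ν : Measure Y} [IsProbabilityMeasure μ] [IsProbabilityMeasure ν]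
    {r : Ω × Y → Ω} (hr : MeasurePreserving r (μ.prod ν) μ) {D h : Ω → ℝ} {k : Y → ℝ}
    (hD : Measurable D) (hh : Measurable h)
    (hDr : ∀ ω y, D (r (ω, y)) = D ω) (hhr : ∀ ω y, h (r (ω, y)) = k y) :
    ∫ ω, D ω * h ω ∂μ = (∫ ω, D ω ∂μ) * ∫ y, k y ∂ν := by
  rw [← integral_prod_mul]
  conv_lhs => rw [← hr.map_eq]
  refine (integral_map hr.measurable.aemeasurable (hD.mul hh).aestronglyMeasurable).trans ?_
  refine integral_congr_ae (Filter.Eventually.of_forall ?_)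
  rintro ⟨ω, y⟩
  simp [hDr, hhr]

/-- It suffices to test boxes: the preimage of a box frees side `t` in the first factor and imposes
it on the fresh coordinate instead. -/
theorem measurePreserving_update {ι : Type*} [Fintype ι] [DecidableEq ι] {α : ι → Type*}
    [∀ i, MeasurableSpace (α i)] (μ : ∀ i, Measure (α i)) [∀ i, IsProbabilityMeasure (μ i)]
    (t : ι) :
    MeasurePreserving (fun p : (∀ i, α i) × α t => Function.update p.1 t p.2)
      ((Measure.pi μ).prod (μ t)) (Measure.pi μ) := by
  refine ⟨measurable_update', (Measure.pi_eq fun s hs => ?_).symm⟩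
  rw [Measure.map_apply measurable_update' (MeasurableSet.univ_pi hs)]
  have : (fun p : (∀ i, α i) × α t => Function.update p.1 t p.2) ⁻¹' Set.univ.pi s
      = Set.univ.pi (Function.update s t Set.univ) ×ˢ s t := by
    ext ⟨x, y⟩
    simp only [Set.mem_preimage, Set.mem_univ_pi, Set.mem_prod]
    constructor
    · intro h
      refine ⟨fun i => ?_, by simpa using h t⟩
      by_cases hi : i = t
      · subst hi; simp
      · simpa [hi] using h i
    · rintro ⟨h, hy⟩ i
      by_cases hi : i = t
      · subst hi; simpa using hy
      · simpa [hi] using h i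
  rw [this, Measure.prod_prod, Measure.pi_pi, ← Finset.prod_erase_mul _ _ (Finset.mem_univ t)]
  conv_rhs => rw [← Finset.prod_erase_mul _ _ (Finset.mem_univ t)]
  simp only [Function.update_self, measure_univ, mul_one]
  congr 1
  refine Finset.prod_congr rfl fun i hi => ?_
  rw [Function.update_of_ne (Finset.ne_of_mem_erase hi)]

theorem measurePreserving_resample_snd {A B Y : Type*} [MeasurableSpace A] [MeasurableSpace B]
    [MeasurableSpace Y] {α : Measure A} {β : Measure B} {ν : Measure Y}
    [IsProbabilityMeasure α] [IsProbabilityMeasure β] [IsProbabilityMeasure ν]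
    {r : B × Y → B} (hr : MeasurePreserving r (β.prod ν) β) :
    MeasurePreserving (fun p : (A × B) × Y => (p.1.1, r (p.1.2, p.2)))
      ((α.prod β).prod ν) (α.prod β) :=
  ((MeasurePreserving.id α).prod hr).comp (measurePreserving_prodAssoc α β ν)

theorem measurePreserving_resample_fst {A B Y : Type*} [MeasurableSpace A] [MeasurableSpace B]
    [MeasurableSpace Y] {α : Measure A} {β : Measure B} {ν : Measure Y}
    [IsProbabilityMeasure α] [IsProbabilityMeasure β] [IsProbabilityMeasure ν]
    {r : A × Y → A} (hr : MeasurePreserving r (α.prod ν) α) :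
    MeasurePreserving (fun p : (A × B) × Y => (r (p.1.1, p.2), p.1.2))
      ((α.prod β).prod ν) (α.prod β) :=
  (Measure.measurePreserving_swap (μ := β) (ν := α)).comp
    ((measurePreserving_resample_snd (α := β) hr).comp
      ((Measure.measurePreserving_swap (μ := α) (ν := β)).prod (MeasurePreserving.id ν)))

end Resampling

/-! ### Decisions are measurable and do not anticipate. -/

namespace Policy

variable {Φ : Finset ℝ} (π : Policy.{u} Φ) {T : ℕ} (σ : Fin T → Φ)

theorem history_congr (s : π.Seed) {e e' : Fin T → Bool} {g g' : Fin T → unitInterval} :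
    ∀ (t : ℕ) (h : t ≤ T), (∀ i : Fin T, (i : ℕ) < t → e i = e' i ∧ g i = g' i) →
      π.history σ s e g t h = π.history σ s e' g' t h
  | 0, _, _ => rfl
  | t + 1, h, H => by
    have ih := history_congr s t (Nat.le_of_succ_le h) fun i hi => H i (Nat.lt_succ_of_lt hi)
    simp only [history]
    rw [ih, (H ⟨t, h⟩ (Nat.lt_succ_self t)).1, (H ⟨t, h⟩ (Nat.lt_succ_self t)).2]

theorem decision_update_error (s : π.Seed) (e : Fin T → Bool) (g : Fin T → unitInterval)
    (t : Fin T) (b : Bool) :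
    π.decision σ s (Function.update e t b) g t = π.decision σ s e g t := by
  unfold decision
  rw [history_congr]
  intro i hi
  exact ⟨Function.update_of_ne (Fin.ne_of_lt hi) _ _, rfl⟩

theorem decision_update_cost (s : π.Seed) (e : Fin T → Bool) (g : Fin T → unitInterval)
    (t : Fin T) (y : unitInterval) :
    π.decision σ s e (Function.update g t y) t = π.decision σ s e g t := by
  unfold decision
  rw [history_congr]
  intro i hi
  exact ⟨rfl, Function.update_of_ne (Fin.ne_of_lt hi) _ _⟩

theorem measurable_act_history {t : ℕ} (h : t ≤ T) (φ : Φ)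
    (hist : Measurable fun ω : π.Seed × ((Fin T → Bool) × (Fin T → unitInterval)) =>
      π.history σ ω.1 ω.2.1 ω.2.2 t h) :
    Measurable fun ω : π.Seed × ((Fin T → Bool) × (Fin T → unitInterval)) =>
      π.act t ω.1 (π.history σ ω.1 ω.2.1 ω.2.2 t h) φ :=
  (π.measurable_act t φ).comp (measurable_fst.prodMk hist)

theorem measurable_history : ∀ (t : ℕ) (h : t ≤ T),
    Measurable fun ω : π.Seed × ((Fin T → Bool) × (Fin T → unitInterval)) =>
      π.history σ ω.1 ω.2.1 ω.2.2 t h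
  | 0, _ => measurable_const
  | t + 1, h => by
    have ih := measurable_history t (Nat.le_of_succ_le h)
    refine measurable_pi_lambda _ fun i => ?_
    refine Fin.lastCases ?_ (fun j => ?_) i
    · simp only [history, Fin.snoc_last]
      refine measurable_const.prodMk (Measurable.ite ?_ ?_ measurable_const)
      · exact π.measurable_act_history σ _ _ ih (measurableSet_singleton true)
      · fun_prop
    · simp only [history, Fin.snoc_castSucc]
      exact (measurable_pi_apply j).comp ih

theorem measurable_decision (t : Fin T) :
    Measurable fun ω : π.Seed × ((Fin T → Bool) × (Fin T → unitInterval)) =>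
      π.decision σ ω.1 ω.2.1 ω.2.2 t :=
  π.measurable_act_history σ _ _ (π.measurable_history σ _ _)

end Policy

/-! ### Regret as an expected sum of gaps. -/

namespace Problem

variable (I : Problem) {S : Type*} [MeasurableSpace S] (ρ : Measure S) [IsProbabilityMeasure ρ]
  {T : ℕ} (σ : Fin T → I.Φ)

theorem isProbabilityMeasure_pi_errorLaw :
    IsProbabilityMeasure (Measure.pi fun t => I.errorLaw (σ t)) :=
  inferInstance

instance isProbabilityMeasure_envLaw : IsProbabilityMeasure (I.envLaw σ) := by
  unfold envLaw; infer_instance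

theorem measurable_slotCost {Ω : Type*} [MeasurableSpace Ω] {d e : Ω → Bool} {g : Ω → unitInterval}
    (hd : Measurable d) (he : Measurable e) (hg : Measurable g) :
    Measurable fun ω => slotCost (d ω) (e ω) (g ω) :=
  Measurable.ite (hd (measurableSet_singleton true)) (measurable_subtype_coe.comp hg)
    (Measurable.ite (he (measurableSet_singleton true)) measurable_const measurable_const)

theorem slotCost_mem (d e : Bool) (g : unitInterval) : slotCost d e g ∈ Set.Icc (0 : ℝ) 1 := by
  unfold slotCost
  split_ifs
  exacts [g.2, by simp, by simp]

theorem integrable_slotCost {Ω : Type*} [MeasurableSpace Ω] (μ : Measure Ω) [IsFiniteMeasure μ]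
    {d e : Ω → Bool} {g : Ω → unitInterval}
    (hd : Measurable d) (he : Measurable e) (hg : Measurable g) :
    Integrable (fun ω => slotCost (d ω) (e ω) (g ω)) μ :=
  Integrable.of_bound (measurable_slotCost hd he hg).aestronglyMeasurable 1
    (Filter.Eventually.of_forall fun ω => by
      have := slotCost_mem (d ω) (e ω) (g ω)
      rw [Real.norm_of_nonneg this.1]; exact this.2)

theorem integral_errorLaw (φ : I.Φ) :
    ∫ e, (if e = true then (1 : ℝ) else 0) ∂(I.errorLaw φ) = 1 - I.f φ := by
  have h := I.f_mem φ (I.Φ_subset _ φ.2)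
  rw [Problem.errorLaw, integral_add_measure
      ((integrable_dirac (by simp)).smul_measure ENNReal.ofReal_ne_top)
      ((integrable_dirac (by simp)).smul_measure ENNReal.ofReal_ne_top)]
  simp [integral_smul_measure, ENNReal.toReal_ofReal, sub_nonneg.2 h.2]

/-- A decision that depends on neither the error indicator nor the offloading cost of the current
slot has the expected cost obtained by averaging these out. -/
theorem integral_slotCost_of_nonanticipating
    {d : S × ((Fin T → Bool) × (Fin T → unitInterval)) → Bool} (hd : Measurable d) (t : Fin T)
    (hde : ∀ s e g b, d (s, (Function.update e t b, g)) = d (s, (e, g)))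
    (hdg : ∀ s e g y, d (s, (e, Function.update g t y)) = d (s, (e, g))) :
    ∫ ω, slotCost (d ω) (ω.2.1 t) (ω.2.2 t) ∂(ρ.prod (I.envLaw σ)) =
      ∫ ω, (if d ω = true then I.γ else 1 - I.f (σ t)) ∂(ρ.prod (I.envLaw σ)) := by
  have hmD : Measurable fun ω => if d ω = true then (1 : ℝ) else 0 :=
    Measurable.ite (hd (measurableSet_singleton true)) measurable_const measurable_const
  have hmA : Measurable fun ω => if d ω = true then (0 : ℝ) else 1 :=
    Measurable.ite (hd (measurableSet_singleton true)) measurable_const measurable_const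
  have hme : Measurable fun ω : S × ((Fin T → Bool) × (Fin T → unitInterval)) =>
      if ω.2.1 t = true then (1 : ℝ) else 0 :=
    Measurable.ite ((show Measurable fun ω : S × ((Fin T → Bool) × (Fin T → unitInterval)) =>
      ω.2.1 t by fun_prop) (measurableSet_singleton true)) measurable_const measurable_const
  have hmg : Measurable fun ω : S × ((Fin T → Bool) × (Fin T → unitInterval)) =>
      ((ω.2.2 t : unitInterval) : ℝ) := by fun_prop
  -- Redraw only the cost of slot `t`; the decision in that slot does not notice.
  have hg := integral_mul_of_resample
    (measurePreserving_resample_snd (α := ρ) (measurePreserving_resample_snd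
      (α := Measure.pi fun t => I.errorLaw (σ t))
      (measurePreserving_update (fun _ : Fin T => I.costLaw) t)))
    (h := fun ω => ((ω.2.2 t : unitInterval) : ℝ)) (k := fun y => (y : ℝ)) hmD hmg
    (by rintro ⟨s, e, g⟩ y; simp [hdg]) (by rintro ⟨s, e, g⟩ y; simp)
  -- Likewise for the error indicator of slot `t`, paired with the event of accepting.
  have he := integral_mul_of_resample
    (measurePreserving_resample_snd (α := ρ) (measurePreserving_resample_fst
      (β := Measure.pi fun _ : Fin T => I.costLaw)
      (measurePreserving_update (fun t => I.errorLaw (σ t)) t)))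
    (h := fun ω => if ω.2.1 t = true then (1 : ℝ) else 0)
    (k := fun b => if b = true then (1 : ℝ) else 0) hmA hme
    (by rintro ⟨s, e, g⟩ y; simp [hde]) (by rintro ⟨s, e, g⟩ y; simp)
  rw [integral_errorLaw] at he
  have key : ∀ F : S × ((Fin T → Bool) × (Fin T → unitInterval)) → ℝ, Measurable F →
      (∀ ω, F ω ∈ Set.Icc (0 : ℝ) 1) → Integrable F (ρ.prod (I.envLaw σ)) := fun F hF hb =>
    Integrable.of_bound hF.aestronglyMeasurable 1 (Filter.Eventually.of_forall fun ω => by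
      rw [Real.norm_of_nonneg (hb ω).1]; exact (hb ω).2)
  have iD := key _ hmD fun ω => by split_ifs <;> simp
  have iA := key _ hmA fun ω => by split_ifs <;> simp
  have iG := key _ (hmD.mul hmg) fun ω => by
    simp only [Pi.mul_apply]
    split_ifs
    exacts [by simp, by simp]
  have iE := key _ (hmA.mul hme) fun ω => by
    simp only [Pi.mul_apply]
    split_ifs <;> simp
  calc ∫ ω, slotCost (d ω) (ω.2.1 t) (ω.2.2 t) ∂(ρ.prod (I.envLaw σ))
      = ∫ ω, ((if d ω = true then (1 : ℝ) else 0) * (ω.2.2 t : ℝ)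
          + (if d ω = true then (0 : ℝ) else 1) * (if ω.2.1 t = true then (1 : ℝ) else 0))
          ∂(ρ.prod (I.envLaw σ)) := by
        refine integral_congr_ae (Filter.Eventually.of_forall fun ω => ?_)
        by_cases h : d ω = true <;> simp [slotCost, h]
    _ = (∫ ω, (if d ω = true then (1 : ℝ) else 0) ∂(ρ.prod (I.envLaw σ))) * I.γ
          + (∫ ω, (if d ω = true then (0 : ℝ) else 1) ∂(ρ.prod (I.envLaw σ)))
            * (1 - I.f (σ t)) := by
        exact (integral_add iG iE).trans (congrArg₂ (· + ·) hg he)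
    _ = _ := by
        rw [← integral_mul_const, ← integral_mul_const,
          ← integral_add (iD.mul_const _) (iA.mul_const _)]
        refine integral_congr_ae (Filter.Eventually.of_forall fun ω => ?_)
        by_cases h : d ω = true <;> simp [h]

/-- The expected regret along given arrivals is the expected sum of the gaps of the decisions. -/
theorem integral_regret (π : Policy.{u} I.Φ) :
    ∫ ω : π.Seed × ((Fin T → Bool) × (Fin T → unitInterval)),
      ((∑ t, slotCost (π.decision σ ω.1 ω.2.1 ω.2.2 t) (ω.2.1 t) (ω.2.2 t))
        - ∑ t, slotCost (I.optDecision (σ t)) (ω.2.1 t) (ω.2.2 t))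
      ∂(π.seedLaw.prod (I.envLaw σ)) =
    ∫ ω : π.Seed × ((Fin T → Bool) × (Fin T → unitInterval)),
      ∑ t, ((if π.decision σ ω.1 ω.2.1 ω.2.2 t = true then I.γ else 1 - I.f (σ t))
        - (if I.optDecision (σ t) = true then I.γ else 1 - I.f (σ t)))
      ∂(π.seedLaw.prod (I.envLaw σ)) := by
  have hi : ∀ (d : π.Seed × ((Fin T → Bool) × (Fin T → unitInterval)) → Bool) (_ : Measurable d)
      (t : Fin T), Integrable (fun ω => slotCost (d ω) (ω.2.1 t) (ω.2.2 t))
        (π.seedLaw.prod (I.envLaw σ)) := fun d hd t =>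
    integrable_slotCost _ hd (by fun_prop) (by fun_prop)
  have hj : ∀ (d : π.Seed × ((Fin T → Bool) × (Fin T → unitInterval)) → Bool) (_ : Measurable d)
      (a b : ℝ), Integrable (fun ω => if d ω = true then a else b)
        (π.seedLaw.prod (I.envLaw σ)) := fun d hd a b =>
    Integrable.of_bound (Measurable.ite (hd (measurableSet_singleton true)) measurable_const
      measurable_const).aestronglyMeasurable (max |a| |b|) (Filter.Eventually.of_forall fun ω => by
        split_ifs <;> simp)
  simp only [← Finset.sum_sub_distrib]
  refine (integral_finsetSum _ fun t _ => (hi _ (π.measurable_decision σ t) t).sub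
      (hi (fun _ => I.optDecision (σ t)) measurable_const t)).trans (Eq.trans ?_
    (integral_finsetSum _ fun t _ => (hj _ (π.measurable_decision σ t) _ _).sub
      (hj (fun _ => I.optDecision (σ t)) measurable_const _ _)).symm)
  refine Finset.sum_congr rfl fun t _ => ?_
  simp only [Pi.sub_apply]
  rw [integral_sub (hi _ (π.measurable_decision σ t) t)
      (hi (fun _ => I.optDecision (σ t)) measurable_const t),
    integral_sub (hj _ (π.measurable_decision σ t) _ _)
      (hj (fun _ => I.optDecision (σ t)) measurable_const _ _),
    integral_slotCost_of_nonanticipating I π.seedLaw σ (π.measurable_decision σ t) t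
      (fun s e g b => π.decision_update_error σ s e g t b)
      (fun s e g y => π.decision_update_cost σ s e g t y),
    integral_slotCost_of_nonanticipating I π.seedLaw σ
      (d := fun _ => I.optDecision (σ t)) measurable_const t
      (fun _ _ _ _ => rfl) (fun _ _ _ _ => rfl)]

theorem le_regret (π : Policy.{u} I.Φ) :
    ∫ ω : π.Seed × ((Fin T → Bool) × (Fin T → unitInterval)),
      ∑ t, ((if π.decision σ ω.1 ω.2.1 ω.2.2 t = true then I.γ else 1 - I.f (σ t))
        - (if I.optDecision (σ t) = true then I.γ else 1 - I.f (σ t)))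
      ∂(π.seedLaw.prod (I.envLaw σ)) ≤ I.regret π T := by
  rw [← integral_regret]
  exact le_ciSup (f := fun σ : Fin T → I.Φ =>
    ∫ ω : π.Seed × ((Fin T → Bool) × (Fin T → unitInterval)),
      ((∑ t, slotCost (π.decision σ ω.1 ω.2.1 ω.2.2 t) (ω.2.1 t) (ω.2.2 t))
        - ∑ t, slotCost (I.optDecision (σ t)) (ω.2.1 t) (ω.2.2 t))
      ∂(π.seedLaw.prod (I.envLaw σ))) (Set.finite_range _).bddAbove σ

end Problem

/-! ### Densities of product laws and the second-moment comparison. -/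

section ChangeOfMeasure

/-- On a box, the integral of the product density factors by Fubini into the masses of the sides. -/
theorem pi_withDensity_ofReal {ι Y : Type*} [Fintype ι] [MeasurableSpace Y] (ν : Measure Y)
    [IsProbabilityMeasure ν] {l : Y → ℝ} (h0 : ∀ y, 0 ≤ l y)
    (hi : Integrable l ν) :
    Measure.pi (fun _ : ι => ν.withDensity fun y => ENNReal.ofReal (l y)) =
      (Measure.pi fun _ : ι => ν).withDensity fun g => ENNReal.ofReal (∏ i, l (g i)) := by
  have : IsFiniteMeasure (ν.withDensity fun y => ENNReal.ofReal (l y)) :=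
    isFiniteMeasure_withDensity_ofReal hi.2
  refine Measure.pi_eq fun s hs => ?_
  rw [withDensity_apply _ (MeasurableSet.univ_pi hs), Measure.restrict_pi_pi,
    ← ofReal_integral_eq_lintegral_ofReal
      (Integrable.fintype_prod (f := fun _ => l) fun i => hi.restrict)
      (Filter.Eventually.of_forall fun g => Finset.prod_nonneg fun i _ => h0 (g i)),
    integral_fintype_prod_eq_prod (fun _ => l),
    ENNReal.ofReal_prod_of_nonneg fun i _ => integral_nonneg h0]
  refine Finset.prod_congr rfl fun i _ => ?_
  rw [withDensity_apply _ (hs i), ofReal_integral_eq_lintegral_ofReal hi.restrict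
    (Filter.Eventually.of_forall h0)]

/-- Under a change of measure whose density has second moment at most `1 + 1 / 4`, the mean of a
variable with values in `[0, K]` drops by at most `K / 2`. -/
theorem integral_sub_le_integral_withDensity {Ω : Type*} [MeasurableSpace Ω] {μ : Measure Ω}
    [IsProbabilityMeasure μ] {W X : Ω → ℝ} {C K : ℝ} (hW : Measurable W) (hX : Measurable X)
    (hW0 : ∀ ω, 0 ≤ W ω) (hWC : ∀ ω, W ω ≤ C) (hX0 : ∀ ω, 0 ≤ X ω) (hXK : ∀ ω, X ω ≤ K)
    (h1 : ∫ ω, W ω ∂μ = 1) (h2 : ∫ ω, W ω ^ 2 ∂μ ≤ 1 + 1 / 4) :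
    ∫ ω, X ω ∂μ - K / 2 ≤ ∫ ω, X ω ∂(μ.withDensity fun ω => ENNReal.ofReal (W ω)) := by
  have hb : ∀ {F : Ω → ℝ} {B : ℝ}, Measurable F → (∀ ω, 0 ≤ F ω) → (∀ ω, F ω ≤ B) →
      Integrable F μ := fun hF hF0 hFB =>
    Integrable.of_bound hF.aestronglyMeasurable _ (Filter.Eventually.of_forall fun ω => by
      rw [Real.norm_of_nonneg (hF0 ω)]; exact hFB ω)
  have iW := hb hW hW0 hWC
  have iX := hb hX hX0 hXK
  have iW2 : Integrable (fun ω => W ω ^ 2) μ := hb (hW.pow_const 2) (fun ω => sq_nonneg _)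
    (fun ω => pow_le_pow_left₀ (hW0 ω) (hWC ω) 2)
  have iWX : Integrable (fun ω => W ω * X ω) μ := hb (hW.mul hX)
    (fun ω => mul_nonneg (hW0 ω) (hX0 ω))
    (fun ω => mul_le_mul (hWC ω) (hXK ω) (hX0 ω) ((hW0 ω).trans (hWC ω)))
  rw [integral_withDensity_eq_integral_toReal_smul (by fun_prop)
    (Filter.Eventually.of_forall fun ω => ENNReal.ofReal_lt_top)]
  -- A point of `Ω` is needed only to conclude `0 ≤ K`.
  have hne : Nonempty Ω := by
    by_contra h
    rw [not_nonempty_iff] at h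
    exact (IsProbabilityMeasure.ne_zero μ) (Measure.eq_zero_of_isEmpty μ)
  have hK : 0 ≤ K := (hX0 hne.some).trans (hXK _)
  -- The quadratic is `(W - 1)² + 1 / 4`. It dominates `1 - W` because the difference is `(W - 1 /
  -- 2)²`, and its mean is at most `1 / 4 + 1 / 4`.
  have hpt : ∀ ω, X ω - K * (W ω ^ 2 - 2 * W ω + 5 / 4) ≤ W ω * X ω := fun ω => by
    have ha : (1 - W ω) * X ω ≤ K * (W ω ^ 2 - 2 * W ω + 5 / 4) := by
      have hq : 1 - W ω ≤ W ω ^ 2 - 2 * W ω + 5 / 4 := by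
        nlinarith [sq_nonneg (W ω - 1 / 2)]
      have hq' : 0 ≤ W ω ^ 2 - 2 * W ω + 5 / 4 := by nlinarith [sq_nonneg (W ω - 1)]
      calc _ ≤ (W ω ^ 2 - 2 * W ω + 5 / 4) * X ω := mul_le_mul_of_nonneg_right hq (hX0 ω)
        _ ≤ (W ω ^ 2 - 2 * W ω + 5 / 4) * K := mul_le_mul_of_nonneg_left (hXK ω) hq'
        _ = _ := mul_comm _ _
    linarith
  have iS : Integrable (fun ω => W ω ^ 2 - 2 * W ω) μ := iW2.sub (iW.const_mul 2)
  have iR : Integrable (fun ω => K * (W ω ^ 2 - 2 * W ω + 5 / 4)) μ :=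
    (iS.add (integrable_const _)).const_mul K
  have hR : ∫ ω, K * (W ω ^ 2 - 2 * W ω + 5 / 4) ∂μ ≤ K / 2 := by
    have e : ∫ ω, K * (W ω ^ 2 - 2 * W ω + 5 / 4) ∂μ
        = K * (∫ ω, W ω ^ 2 ∂μ - 3 / 4) := by
      rw [integral_const_mul, integral_add iS (integrable_const _),
        integral_sub iW2 (iW.const_mul 2), integral_const_mul, h1]
      simp
      ring_nf
      simp
    rw [e]
    nlinarith
  calc ∫ ω, X ω ∂μ - K / 2
      ≤ ∫ ω, X ω ∂μ - ∫ ω, K * (W ω ^ 2 - 2 * W ω + 5 / 4) ∂μ := by linarith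
    _ = ∫ ω, (X ω - K * (W ω ^ 2 - 2 * W ω + 5 / 4)) ∂μ := (integral_sub iX iR).symm
    _ ≤ ∫ ω, W ω * X ω ∂μ := integral_mono (iX.sub iR) iWX hpt
    _ = _ := by simp [ENNReal.toReal_ofReal (hW0 _)]

end ChangeOfMeasure

/-! ### Bernoulli cost laws and their tilts. -/

section CostLaws

/-- The Bernoulli law with mean `m`. -/
noncomputable def bernoulliLaw (m : ℝ) : Measure unitInterval :=
  ENNReal.ofReal m • Measure.dirac 1 + ENNReal.ofReal (1 - m) • Measure.dirac 0

theorem isProbabilityMeasure_bernoulliLaw {m : ℝ} (h0 : 0 ≤ m) (h1 : m ≤ 1) :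
    IsProbabilityMeasure (bernoulliLaw m) := by
  constructor
  simp only [bernoulliLaw, Measure.add_apply, Measure.smul_apply, measure_univ, smul_eq_mul,
    mul_one]
  rw [← ENNReal.ofReal_add h0 (by linarith)]
  simp

theorem integral_bernoulliLaw {m : ℝ} (h0 : 0 ≤ m) (h1 : m ≤ 1) {h : unitInterval → ℝ} :
    ∫ x, h x ∂(bernoulliLaw m) = m * h 1 + (1 - m) * h 0 := by
  rw [bernoulliLaw, integral_add_measure
      ((integrable_dirac (by simp)).smul_measure ENNReal.ofReal_ne_top)
      ((integrable_dirac (by simp)).smul_measure ENNReal.ofReal_ne_top)]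
  simp [integral_smul_measure, ENNReal.toReal_ofReal, h0, sub_nonneg.2 h1]

/-- The affine density with respect to the Bernoulli law with mean `m` that has slope `δ`. -/
def tilt (m δ : ℝ) (x : unitInterval) : ℝ := 1 + δ * ((x : ℝ) - m)

theorem measurable_tilt (m δ : ℝ) : Measurable (tilt m δ) := by
  unfold tilt; fun_prop

theorem tilt_nonneg {m δ : ℝ} (hδ : 0 ≤ δ) (h : δ * m ≤ 1) (x : unitInterval) :
    0 ≤ tilt m δ x := by
  have := mul_nonneg hδ x.2.1
  unfold tilt
  linarith

theorem tilt_le {m δ : ℝ} (hδ : 0 ≤ δ) (hm : 0 ≤ m) (x : unitInterval) :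
    tilt m δ x ≤ 1 + δ := by
  have := mul_le_mul_of_nonneg_left x.2.2 hδ
  have := mul_nonneg hδ hm
  unfold tilt
  linarith

variable {m δ : ℝ}

theorem integral_tilt (h0 : 0 ≤ m) (h1 : m ≤ 1) : ∫ x, tilt m δ x ∂(bernoulliLaw m) = 1 := by
  rw [integral_bernoulliLaw h0 h1]
  simp [tilt]
  ring

theorem integral_tilt_sq (h0 : 0 ≤ m) (h1 : m ≤ 1) :
    ∫ x, tilt m δ x ^ 2 ∂(bernoulliLaw m) = 1 + δ ^ 2 * (m * (1 - m)) := by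
  rw [integral_bernoulliLaw h0 h1]
  simp [tilt]
  ring

theorem integrable_tilt (h0 : 0 ≤ m) (h1 : m ≤ 1) (hδ : 0 ≤ δ) (h : δ * m ≤ 1) :
    Integrable (tilt m δ) (bernoulliLaw m) := by
  have := isProbabilityMeasure_bernoulliLaw h0 h1
  exact Integrable.of_bound (measurable_tilt m δ).aestronglyMeasurable (1 + δ)
    (Filter.Eventually.of_forall fun x => by
      rw [Real.norm_of_nonneg (tilt_nonneg hδ h x)]; exact tilt_le hδ h0 x)

/-- The Bernoulli law with mean `m`, tilted by the affine density with slope `δ`. -/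
noncomputable def tiltedLaw (m δ : ℝ) : Measure unitInterval :=
  (bernoulliLaw m).withDensity fun x => ENNReal.ofReal (tilt m δ x)

theorem isProbabilityMeasure_tiltedLaw (h0 : 0 ≤ m) (h1 : m ≤ 1) (hδ : 0 ≤ δ) (h : δ * m ≤ 1) :
    IsProbabilityMeasure (tiltedLaw m δ) := by
  constructor
  rw [tiltedLaw, withDensity_apply _ MeasurableSet.univ, Measure.restrict_univ,
    ← ofReal_integral_eq_lintegral_ofReal (integrable_tilt h0 h1 hδ h)
      (Filter.Eventually.of_forall (tilt_nonneg hδ h)), integral_tilt h0 h1, ENNReal.ofReal_one]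

theorem integral_tiltedLaw (h0 : 0 ≤ m) (h1 : m ≤ 1) (hδ : 0 ≤ δ) (h : δ * m ≤ 1) :
    ∫ x, (x : ℝ) ∂(tiltedLaw m δ) = m + δ * (m * (1 - m)) := by
  have hm := measurable_tilt m δ
  rw [tiltedLaw, integral_withDensity_eq_integral_toReal_smul (by fun_prop)
    (Filter.Eventually.of_forall fun ω => ENNReal.ofReal_lt_top)]
  simp only [ENNReal.toReal_ofReal (tilt_nonneg hδ h _)]
  rw [integral_bernoulliLaw h0 h1]
  simp [tilt]
  ring

end CostLaws

/-! ### Regret in terms of the number of offloads, and the change of cost law. -/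

section TwoPoint

variable {T : ℕ}

/-- The number of offloaded samples. -/
def Policy.offloads {Φ : Finset ℝ} (π : Policy.{u} Φ) (σ : Fin T → Φ)
    (ω : π.Seed × ((Fin T → Bool) × (Fin T → unitInterval))) : ℝ :=
  ∑ t, if π.decision σ ω.1 ω.2.1 ω.2.2 t = true then (1 : ℝ) else 0

theorem Policy.measurable_offloads {Φ : Finset ℝ} (π : Policy.{u} Φ) (σ : Fin T → Φ) :
    Measurable (π.offloads σ) :=
  Finset.measurable_fun_sum _ fun t _ =>
    Measurable.ite (π.measurable_decision σ t (measurableSet_singleton true)) measurable_const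
      measurable_const

theorem Policy.offloads_nonneg {Φ : Finset ℝ} (π : Policy.{u} Φ) (σ : Fin T → Φ)
    (ω : π.Seed × ((Fin T → Bool) × (Fin T → unitInterval))) : 0 ≤ π.offloads σ ω :=
  Finset.sum_nonneg fun t _ => by split_ifs <;> simp

theorem Policy.offloads_le {Φ : Finset ℝ} (π : Policy.{u} Φ) (σ : Fin T → Φ)
    (ω : π.Seed × ((Fin T → Bool) × (Fin T → unitInterval))) : π.offloads σ ω ≤ T := by
  unfold offloads
  refine (Finset.sum_le_card_nsmul _ _ 1 fun t _ => by split_ifs <;> simp).trans ?_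
  simp

theorem Policy.integrable_offloads {Φ : Finset ℝ} (π : Policy.{u} Φ) (σ : Fin T → Φ)
    (μ : Measure (π.Seed × ((Fin T → Bool) × (Fin T → unitInterval)))) [IsFiniteMeasure μ] :
    Integrable (π.offloads σ) μ :=
  Integrable.of_bound (π.measurable_offloads σ).aestronglyMeasurable T
    (Filter.Eventually.of_forall fun ω => by
      rw [Real.norm_of_nonneg (π.offloads_nonneg σ ω)]; exact π.offloads_le σ ω)

namespace Problem

/-- If offloading is optimal, every accepted sample costs the gap. -/
theorem gap_mul_accepts_le_regret (I : Problem) (π : Policy.{u} I.Φ) (σ : Fin T → I.Φ) {p : ℝ}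
    (hp : ∀ t, 1 - I.f (σ t) = p) (hγ : I.γ ≤ p) :
    (p - I.γ) * (T - ∫ ω, π.offloads σ ω ∂(π.seedLaw.prod (I.envLaw σ))) ≤ I.regret π T := by
  refine le_of_eq_of_le ?_ (I.le_regret σ π)
  have h : ∀ ω : π.Seed × ((Fin T → Bool) × (Fin T → unitInterval)),
      ∑ t, ((if π.decision σ ω.1 ω.2.1 ω.2.2 t = true then I.γ else 1 - I.f (σ t))
        - (if I.optDecision (σ t) = true then I.γ else 1 - I.f (σ t)))
      = (p - I.γ) * (T - π.offloads σ ω) := fun ω => by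
    have hT : (T : ℝ) = ∑ _t : Fin T, (1 : ℝ) := by simp
    rw [Policy.offloads, hT, ← Finset.sum_sub_distrib, Finset.mul_sum]
    refine Finset.sum_congr rfl fun t _ => ?_
    simp only [optDecision, hp, hγ, decide_true, if_true]
    split_ifs <;> ring
  simp only [h]
  rw [integral_const_mul, integral_sub (integrable_const _) (π.integrable_offloads σ _)]
  simp

/-- If accepting is optimal, every offloaded sample costs the gap. -/
theorem gap_mul_offloads_le_regret (I : Problem) (π : Policy.{u} I.Φ) (σ : Fin T → I.Φ) {p : ℝ}
    (hp : ∀ t, 1 - I.f (σ t) = p) (hγ : p < I.γ) :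
    (I.γ - p) * ∫ ω, π.offloads σ ω ∂(π.seedLaw.prod (I.envLaw σ)) ≤ I.regret π T := by
  refine le_of_eq_of_le ?_ (I.le_regret σ π)
  have h : ∀ ω : π.Seed × ((Fin T → Bool) × (Fin T → unitInterval)),
      ∑ t, ((if π.decision σ ω.1 ω.2.1 ω.2.2 t = true then I.γ else 1 - I.f (σ t))
        - (if I.optDecision (σ t) = true then I.γ else 1 - I.f (σ t)))
      = (I.γ - p) * π.offloads σ ω := fun ω => by
    rw [Policy.offloads, Finset.mul_sum]
    refine Finset.sum_congr rfl fun t _ => ?_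
    simp only [optDecision, hp, not_le.2 hγ, decide_false, Bool.false_eq_true, if_false]
    split_ifs <;> ring
  simp only [h]
  rw [integral_const_mul]

/-- The instance with the single confidence value `φ`. -/
def singleton {f : ℝ → ℝ} (hf : MonotoneOn f (Set.Ioc 0 1))
    (hf' : ∀ φ ∈ Set.Ioc (0 : ℝ) 1, f φ ∈ Set.Icc (0 : ℝ) 1) {φ : ℝ} (hφ : φ ∈ Set.Ioc (0 : ℝ) 1)
    {Λ : Measure unitInterval} (hΛ : IsProbabilityMeasure Λ) : Problem where
  Φ := {φ}
  Φ_nonempty := Finset.singleton_nonempty φ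
  Φ_subset := fun ψ hψ => by rwa [Finset.mem_singleton.1 hψ]
  f := f
  f_mono := hf
  f_mem := hf'
  costLaw := Λ
  costLaw_prob := hΛ

end Problem

variable {S E : Type*} [MeasurableSpace S] [MeasurableSpace E] (ρ : Measure S) (η : Measure E)
  [IsProbabilityMeasure η] {m δ : ℝ}

/-- Seed and errors have the same law in both environments, so the likelihood ratio involves the
costs alone and pulls out of each product. -/
theorem prod_pi_tiltedLaw (hm0 : 0 ≤ m) (hm1 : m ≤ 1) (hδ : 0 ≤ δ) (hδm : δ * m ≤ 1) :
    ρ.prod (η.prod (Measure.pi fun _ : Fin T => tiltedLaw m δ)) =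
      (ρ.prod (η.prod (Measure.pi fun _ : Fin T => bernoulliLaw m))).withDensity
        fun ω => ENNReal.ofReal (∏ i, tilt m δ (ω.2.2 i)) := by
  have := isProbabilityMeasure_bernoulliLaw hm0 hm1
  have := isProbabilityMeasure_tiltedLaw hm0 hm1 hδ hδm
  have hW : Measurable fun g : Fin T → unitInterval => ENNReal.ofReal (∏ i, tilt m δ (g i)) :=
    (Finset.measurable_fun_prod _ fun i _ =>
      (measurable_tilt m δ).comp (measurable_pi_apply i)).ennreal_ofReal
  have hpi : Measure.pi (fun _ : Fin T => tiltedLaw m δ) = _ :=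
    pi_withDensity_ofReal (bernoulliLaw m) (tilt_nonneg hδ hδm)
      (integrable_tilt hm0 hm1 hδ hδm)
  have hs : SFinite ((Measure.pi fun _ : Fin T => bernoulliLaw m).withDensity
      fun g => ENNReal.ofReal (∏ i, tilt m δ (g i))) := by
    rw [← hpi]; infer_instance
  rw [hpi, prod_withDensity_right hW]
  have hs' : SFinite ((η.prod (Measure.pi fun _ : Fin T => bernoulliLaw m)).withDensity
      fun ω => ENNReal.ofReal (∏ i, tilt m δ (ω.2 i))) := by
    rw [← prod_withDensity_right hW]; infer_instance
  exact prod_withDensity_right (hW.comp measurable_snd)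

/-- The second moment of the likelihood ratio factors over the slots; each factor is one plus `δ ^
2` times the Bernoulli variance. -/
theorem integral_sub_le_integral_tiltedLaw [IsProbabilityMeasure ρ] (hm0 : 0 ≤ m) (hm1 : m ≤ 1) (hδ : 0 ≤ δ)
    (hδm : δ * m ≤ 1) (hT : (1 + δ ^ 2 * (m * (1 - m))) ^ T ≤ 1 + 1 / 4)
    {X : S × (E × (Fin T → unitInterval)) → ℝ} {K : ℝ} (hX : Measurable X) (hX0 : ∀ ω, 0 ≤ X ω)
    (hXK : ∀ ω, X ω ≤ K) :
    ∫ ω, X ω ∂(ρ.prod (η.prod (Measure.pi fun _ : Fin T => bernoulliLaw m))) - K / 2 ≤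
      ∫ ω, X ω ∂(ρ.prod (η.prod (Measure.pi fun _ : Fin T => tiltedLaw m δ))) := by
  have := isProbabilityMeasure_bernoulliLaw hm0 hm1
  rw [prod_pi_tiltedLaw ρ η hm0 hm1 hδ hδm]
  have hg : MeasurePreserving (fun ω : S × (E × (Fin T → unitInterval)) => ω.2.2)
      (ρ.prod (η.prod (Measure.pi fun _ : Fin T => bernoulliLaw m)))
      (Measure.pi fun _ => bernoulliLaw m) :=
    measurePreserving_snd.comp measurePreserving_snd
  have hmW : Measurable fun g : Fin T → unitInterval => ∏ i, tilt m δ (g i) :=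
    Finset.measurable_fun_prod _ fun i _ => (measurable_tilt m δ).comp (measurable_pi_apply i)
  have hint : ∀ F : (Fin T → unitInterval) → ℝ, Measurable F →
      ∫ ω, F ω.2.2 ∂(ρ.prod (η.prod (Measure.pi fun _ : Fin T => bernoulliLaw m))) =
        ∫ g, F g ∂(Measure.pi fun _ : Fin T => bernoulliLaw m) := fun F hF => by
    conv_rhs => rw [← hg.map_eq]
    rw [integral_map hg.measurable.aemeasurable hF.aestronglyMeasurable]
  -- The bound `C` serves integrability only and does not enter the estimate.
  refine integral_sub_le_integral_withDensity (C := (1 + δ) ^ T) (hmW.comp hg.measurable)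
    hX (fun ω => Finset.prod_nonneg fun i _ => tilt_nonneg hδ hδm _)
    (fun ω => ?_) hX0 hXK ?_ ?_
  · refine (Finset.prod_le_prod (fun i _ => tilt_nonneg hδ hδm _)
      fun i _ => tilt_le hδ hm0 (ω.2.2 i)).trans ?_
    simp
  · refine (hint _ hmW).trans ?_
    rw [integral_fintype_prod_eq_prod fun _ => tilt m δ]
    simp [integral_tilt hm0 hm1]
  · refine le_of_eq_of_le ((hint _ (hmW.pow_const 2)).trans ?_) hT
    simp only [← Finset.prod_pow]
    rw [integral_fintype_prod_eq_prod fun _ x => tilt m δ x ^ 2]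
    simp [integral_tilt_sq hm0 hm1]

end TwoPoint

/-! ### The two-point argument and the conclusion. -/

/-- With the accuracy mapping held fixed, the minimax regret is at least of order `√T`. -/
theorem exists_sqrt_le_regret {f : ℝ → ℝ} (hf : MonotoneOn f (Set.Ioc 0 1))
    (hf' : ∀ φ ∈ Set.Ioc (0 : ℝ) 1, f φ ∈ Set.Icc (0 : ℝ) 1) {φ : ℝ}
    (hφ : φ ∈ Set.Ioc (0 : ℝ) 1) (hfφ : f φ ∈ Set.Ioo (0 : ℝ) 1) {T : ℕ} (hT : 1 ≤ T)
    (π : (Φ : Finset ℝ) → Policy.{u} Φ) :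
    ∃ I : Problem, I.f = f ∧ (1 - f φ) * f φ / 32 * √T ≤ I.regret (π I.Φ) T := by
  obtain ⟨p, hp⟩ : ∃ p, p = 1 - f φ := ⟨_, rfl⟩
  have hp0 : 0 < p := by linarith [hfφ.2]
  have hp1 : p < 1 := by linarith [hfφ.1]
  have hfp : f φ = 1 - p := by linarith
  rw [hfp, sub_sub_cancel]
  set q := p * (1 - p) with hq
  have hq0 : 0 < q := mul_pos hp0 (by linarith)
  have hqp : q ≤ p := by nlinarith
  have hqp' : q ≤ 1 - p := by nlinarith
  set r := √(T : ℝ) with hr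
  have hT' : (1 : ℝ) ≤ T := by exact_mod_cast hT
  have hr1 : 1 ≤ r := Real.one_le_sqrt.2 hT'
  have hr2 : r * r = T := Real.mul_self_sqrt (by linarith)
  -- Order `1 / √T` keeps the two environments hard to distinguish. The factor `q` keeps `p ± Δ`
  -- inside `(0, 1)`, and the `8` brings the second moment below `5 / 4`.
  obtain ⟨Δ, hΔ⟩ : ∃ Δ, Δ = q / (8 * r) := ⟨_, rfl⟩
  have hΔr : Δ * (8 * r) = q := by rw [hΔ]; field_simp
  have hΔ0 : 0 < Δ := by rw [hΔ]; positivity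
  have hΔq : Δ * 8 ≤ q := by nlinarith
  obtain ⟨m, hm⟩ : ∃ m, m = p - Δ := ⟨_, rfl⟩
  have hm0 : 0 < m := by linarith
  have hm1 : m < 1 := by linarith
  have hV0 : 0 < m * (1 - m) := mul_pos hm0 (by linarith)
  have hV : q / 2 ≤ m * (1 - m) := by
    have h1 : p / 2 ≤ m := by linarith
    have h2 : 1 - p ≤ 1 - m := by linarith
    calc q / 2 = p / 2 * (1 - p) := by rw [hq]; ring
      _ ≤ m * (1 - m) := mul_le_mul h1 h2 (by linarith) hm0.le
  -- Tilting raises the mean by `δ` times the variance, so this slope moves it from `p - Δ` to `p +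
  -- Δ`.
  obtain ⟨δ, hδ⟩ : ∃ δ, δ = 2 * Δ / (m * (1 - m)) := ⟨_, rfl⟩
  have hδV : δ * (m * (1 - m)) = 2 * Δ := by rw [hδ, div_mul_cancel₀ _ hV0.ne']
  have hδ0 : 0 ≤ δ := by rw [hδ]; positivity
  -- Nonnegativity of the density at cost `0`: otherwise `1 - m < 2 * Δ`, whereas `1 - m ≥ q + Δ ≥ 9
  -- * Δ`.
  have hδm : δ * m ≤ 1 := by
    have h1 : 0 < 1 - m := by linarith
    by_contra! h
    nlinarith [mul_lt_mul_of_pos_right h h1]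
  have hpow : (1 + δ ^ 2 * (m * (1 - m))) ^ T ≤ 1 + 1 / 4 := by
    -- By `δ ≤ 4 Δ / q`, the left side `2 Δ δ T` is at most `8 Δ² T / q = q / 8`.
    have hx : δ ^ 2 * (m * (1 - m)) * T ≤ 1 / 8 := by
      have h1 : δ * q ≤ 4 * Δ := by nlinarith
      have h2 : δ * T * 2 * Δ * q ≤ 4 * Δ * (T * 2 * Δ) := by
        have := mul_le_mul_of_nonneg_right h1 (show 0 ≤ T * 2 * Δ by positivity)
        linarith
      have h3 : 64 * (Δ * Δ * T) = q * q := by rw [← hr2, ← hΔr]; ring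
      have h4 : δ * T * 2 * Δ * q ≤ q / 8 * q := by linarith
      have h5 : δ * T * 2 * Δ ≤ q / 8 := le_of_mul_le_mul_right h4 hq0
      have h6 : δ ^ 2 * (m * (1 - m)) * T = δ * T * 2 * Δ := by
        rw [sq, mul_assoc δ δ, hδV]; ring
      rw [h6]
      linarith
    have hexp : Real.exp (1 / 8) ≤ 1 + 1 / 4 := by
      have h1 := Real.add_one_le_exp (-(1 / 8) : ℝ)
      have h2 : Real.exp (1 / 8) * Real.exp (-(1 / 8)) = 1 := by rw [← Real.exp_add]; simp
      nlinarith [Real.exp_pos (1 / 8)]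
    calc (1 + δ ^ 2 * (m * (1 - m))) ^ T ≤ Real.exp (δ ^ 2 * (m * (1 - m))) ^ T := by
          refine pow_le_pow_left₀ (by positivity) ?_ T
          linarith [Real.add_one_le_exp (δ ^ 2 * (m * (1 - m)))]
      _ = Real.exp (δ ^ 2 * (m * (1 - m)) * T) := by rw [← Real.exp_nat_mul, mul_comm]
      _ ≤ Real.exp (1 / 8) := Real.exp_le_exp.2 hx
      _ ≤ _ := hexp
  have h₀ := isProbabilityMeasure_bernoulliLaw hm0.le hm1.le
  have h₁ := isProbabilityMeasure_tiltedLaw hm0.le hm1.le hδ0 hδm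
  have hγ₀ : (Problem.singleton hf hf' hφ h₀).γ = p - Δ := by
    refine (integral_bernoulliLaw hm0.le hm1.le).trans ?_
    simp [hm]
  have hγ₁ : (Problem.singleton hf hf' hφ h₁).γ = p + Δ := by
    refine (integral_tiltedLaw hm0.le hm1.le hδ0 hδm).trans ?_
    rw [hδV, hm]; ring
  -- Both instances have confidence set `{φ}`, so they face the same policy `π {φ}` and the same
  -- arrivals.
  let σ : Fin T → ({φ} : Finset ℝ) := fun _ => ⟨φ, Finset.mem_singleton_self φ⟩
  have hη : IsProbabilityMeasure
      (Measure.pi fun t => (Problem.singleton hf hf' hφ h₀).errorLaw (σ t)) :=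
    (Problem.singleton hf hf' hφ h₀).isProbabilityMeasure_pi_errorLaw σ
  -- The error laws depend on `f` alone, so those written for the first instance are also those of
  -- the second.
  have key := integral_sub_le_integral_tiltedLaw (π {φ}).seedLaw
    (Measure.pi fun t => (Problem.singleton hf hf' hφ h₀).errorLaw (σ t))
    hm0.le hm1.le hδ0 hδm hpow
    ((π {φ}).measurable_offloads σ) ((π {φ}).offloads_nonneg σ) ((π {φ}).offloads_le σ)
  have hR₀ := (Problem.singleton hf hf' hφ h₀).gap_mul_accepts_le_regret (π {φ}) σ (p := p)
    (fun _ => hp.symm) (by rw [hγ₀]; linarith)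
  have hR₁ := (Problem.singleton hf hf' hφ h₁).gap_mul_offloads_le_regret (π {φ}) σ (p := p)
    (fun _ => hp.symm) (by rw [hγ₁]; linarith)
  rw [hγ₀, sub_sub_cancel] at hR₀
  rw [hγ₁, add_sub_cancel_left] at hR₁
  have hgoal : q / 32 * r = Δ * (T / 4) := by rw [← hr2, ← hΔr]; ring
  rw [hgoal]
  -- The change of measure loses `T / 2`, so the threshold `3 * T / 4` leaves `T / 4` wrong
  -- decisions in either case.
  obtain hN | hN := le_or_gt (∫ ω, (π {φ}).offloads σ ω ∂((π {φ}).seedLaw.prod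
    ((Measure.pi fun t => (Problem.singleton hf hf' hφ h₀).errorLaw (σ t)).prod
      (Measure.pi fun _ : Fin T => bernoulliLaw m)))) (3 * T / 4)
  · refine ⟨Problem.singleton hf hf' hφ h₀, rfl, le_trans ?_ hR₀⟩
    refine mul_le_mul_of_nonneg_left (le_sub_comm.1 (hN.trans ?_)) hΔ0.le
    linarith
  · refine ⟨Problem.singleton hf hf' hφ h₁, rfl, le_trans ?_ hR₁⟩
    refine mul_le_mul_of_nonneg_left (le_trans ?_ key) hΔ0.le
    linarith

theorem exists_log_le_regret {f : ℝ → ℝ} (hf : MonotoneOn f (Set.Ioc 0 1))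
    (hf' : ∀ φ ∈ Set.Ioc (0 : ℝ) 1, f φ ∈ Set.Icc (0 : ℝ) 1)
    (h : ∃ φ ∈ Set.Ioc (0 : ℝ) 1, f φ ∈ Set.Ioo (0 : ℝ) 1) :
    ∃ c : ℝ, 0 < c ∧ ∃ T₀ : ℕ, ∀ T : ℕ, T₀ ≤ T → ∀ π : (Φ : Finset ℝ) → Policy.{u} Φ,
      ∃ I : Problem, I.f = f ∧ c * Real.log T ≤ I.regret (π I.Φ) T := by
  obtain ⟨φ, hφ, hfφ⟩ := h
  have hc : 0 < (1 - f φ) * f φ := mul_pos (sub_pos.2 hfφ.2) hfφ.1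
  refine ⟨(1 - f φ) * f φ / 64, by positivity, 1, fun T hT π => ?_⟩
  obtain ⟨I, hI, hR⟩ := exists_sqrt_le_regret hf hf' hφ hfφ hT π
  refine ⟨I, hI, le_trans ?_ hR⟩
  have hT' : (0 : ℝ) < T := by exact_mod_cast hT
  have hlog : Real.log T ≤ 2 * √T := by
    have h1 := Real.log_le_sub_one_of_pos (Real.sqrt_pos.2 hT')
    rw [Real.log_sqrt hT'.le] at h1
    linarith
  calc (1 - f φ) * f φ / 64 * Real.log T ≤ (1 - f φ) * f φ / 64 * (2 * √T) := by gcongr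
    _ = _ := by ring

end HI

/-- Lower bound on the minimax adversarial regret: `Ω(log T)`, both when the maximum is over all
problem instances (first part) and when the accuracy mapping is held fixed and the maximum is over
the confidence set and the offloading costs only (second part; there some confidence value must have
an accuracy strictly between `0` and `1`). -/
theorem theorem3 :
    (∃ c : ℝ, 0 < c ∧ ∃ T₀ : ℕ, ∀ T : ℕ, T₀ ≤ T →
      ∀ π : (Φ : Finset ℝ) → HI.Policy.{u} Φ,
        ∃ I : HI.Problem, c * Real.log T ≤ I.regret (π I.Φ) T) ∧
    (∀ f : ℝ → ℝ, MonotoneOn f (Set.Ioc 0 1) →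
      (∀ φ ∈ Set.Ioc (0 : ℝ) 1, f φ ∈ Set.Icc (0 : ℝ) 1) →
      (∃ φ ∈ Set.Ioc (0 : ℝ) 1, f φ ∈ Set.Ioo (0 : ℝ) 1) →
      ∃ c : ℝ, 0 < c ∧ ∃ T₀ : ℕ, ∀ T : ℕ, T₀ ≤ T →
        ∀ π : (Φ : Finset ℝ) → HI.Policy.{u} Φ,
          ∃ I : HI.Problem, I.f = f ∧ c * Real.log T ≤ I.regret (π I.Φ) T) := by
  refine ⟨?_, fun f hf hf' h => HI.exists_log_le_regret hf hf' h⟩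
  -- Any accuracy mapping with a value strictly inside `(0, 1)` would do for the unrestricted bound.
  obtain ⟨c, hc, T₀, h⟩ := HI.exists_log_le_regret (f := fun _ => 1 / 2)
    (fun _ _ _ _ _ => le_rfl) (fun _ _ => by norm_num) ⟨1, by simp, by norm_num⟩
  refine ⟨c, hc, T₀, fun T hT π => ?_⟩
  obtain ⟨I, -, hI⟩ := h T hT π
  exact ⟨I, hI⟩
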